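/- Let $T^2=(\mathbb R/\mathbb Z)\times(\mathbb R/\mathbb Z)$, let $\sim$ be the equivalence relation on $T^2$ identifying each $p$ with $-p$, and let $\pi\colon T^2\to T^2/{\sim}$ be the canonical projection. Let $\tilde f\colon T^2\to T^2$ be the linear Anosov diffeomorphism $\tilde f(x,y)=(2x+y,x+y)$, and let $f\colon T^2/{\sim}\to T^2/{\sim}$ be the homeomorphism it induces, $f(\pi(p))=\pi(\tilde f(p))$. For a homeomorphism $g\colon X\to X$ of a compact metric space and $\delta>0$, a non-empty compact connected set $A\subset X$ is called $\delta$-stable (respectively $\delta$-unstable) if $\operatorname{diam}(g^n(A))\le\delta$ for all integers $n\ge 0$ (respectively $n\le 0$). The homeomorphism $g$ is called cw2-expansive if there is $\delta>0$ such that $A^s\cap A^u$ has at most $2$ points whenever $A^s$ is $\delta$-stable and $A^u$ is $\delta$-unstable. **Proposition.** The quotient $T^2/{\sim}$ is homeomorphic to the two-dimensional sphere, and $f$ is cw2-expansive with respect to every metric on $T^2/{\sim}$ that induces the quotient topology. -/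

import Mathlib

open Topology

section CwExpansive

variable {X : Type*} [MetricSpace X]

/-- The non-empty subcontinua of a metric space: the non-empty compact connected subsets. -/
def subcontinua (X : Type*) [MetricSpace X] : Set (Set X) :=
  {A | IsCompact A ∧ IsConnected A}

/-- The subcontinua of diameter at most `δ`. -/
def smallContinua (X : Type*) [MetricSpace X] (δ : ℝ) : Set (Set X) :=
  {A | A ∈ subcontinua X ∧ Metric.diam A ≤ δ}

/-- The `δ`-stable continua of `f`: all forward iterates have diameter at most `δ`.
Powers of `f` are taken in the group of homeomorphisms of `X`. -/
def stableContinua (f : X ≃ₜ X) (δ : ℝ) : Set (Set X) :=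
  {A | A ∈ subcontinua X ∧ ∀ n : ℤ, 0 ≤ n → (f ^ n) '' A ∈ smallContinua X δ}

/-- The `δ`-unstable continua of `f`: all backward iterates have diameter at most `δ`. -/
def unstableContinua (f : X ≃ₜ X) (δ : ℝ) : Set (Set X) :=
  {A | A ∈ subcontinua X ∧ ∀ n : ℤ, n ≤ 0 → (f ^ n) '' A ∈ smallContinua X δ}

/-- cwN-expansivity of a homeomorphism of a compact metric space: for some `δ > 0`, every
`δ`-stable continuum meets every `δ`-unstable continuum in at most `N` points. -/
def IsCwExpansive (N : ℕ) (f : X ≃ₜ X) : Prop :=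
  ∃ δ : ℝ, 0 < δ ∧ ∀ As ∈ stableContinua f δ, ∀ Au ∈ unstableContinua f δ,
    (As ∩ Au).encard ≤ N

end CwExpansive

/-- The two-dimensional torus `(ℝ/ℤ) × (ℝ/ℤ)`. -/
abbrev Torus : Type := UnitAddCircle × UnitAddCircle

/-- The linear Anosov diffeomorphism `(x, y) ↦ (2x + y, x + y)` of the torus. -/
def torusAnosov : Torus ≃ₜ Torus where
  toFun p := (2 • p.1 + p.2, p.1 + p.2)
  invFun p := (p.1 - p.2, 2 • p.2 - p.1)
  left_inv p := by ext <;> simp only <;> abel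
  right_inv p := by ext <;> simp only <;> abel
  continuous_toFun := by fun_prop
  continuous_invFun := by fun_prop

/-- The equivalence relation `p ∼ -p` on the torus. -/
def negSetoid : Setoid Torus where
  r p q := q = p ∨ q = -p
  iseqv :=
    { refl := fun _ => Or.inl rfl
      symm := by
        rintro p q (h | h)
        · exact Or.inl h.symm
        · exact Or.inr (by rw [h, neg_neg])
      trans := by
        rintro p q r (h | h) (h' | h') <;> subst h <;> subst h' <;> simp }

/-- The quotient `T² / (p ∼ -p)`, with the quotient topology. -/
abbrev TorusModNeg : Type := Quotient negSetoid

/-- The canonical projection. -/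
def torusProj (p : Torus) : TorusModNeg := Quotient.mk negSetoid p

theorem torusAnosov_rel (p q : Torus) (h : negSetoid p q) :
    negSetoid (torusAnosov p) (torusAnosov q) := by
  rcases h with h | h
  · exact Or.inl (by rw [h])
  · refine Or.inr ?_
    subst h
    ext <;> simp [torusAnosov] <;> abel

theorem torusAnosov_symm_rel (p q : Torus) (h : negSetoid p q) :
    negSetoid (torusAnosov.symm p) (torusAnosov.symm q) := by
  rcases h with h | h
  · exact Or.inl (by rw [h])
  · refine Or.inr ?_
    subst h
    change ((-p).1 - (-p).2, 2 • (-p).2 - (-p).1) = -(p.1 - p.2, 2 • p.2 - p.1)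
    ext <;> simp <;> abel

/-- The homeomorphism of `T² / (p ∼ -p)` induced by the linear Anosov diffeomorphism. -/
def sphereMap : TorusModNeg ≃ₜ TorusModNeg where
  toFun := Quotient.map torusAnosov torusAnosov_rel
  invFun := Quotient.map torusAnosov.symm torusAnosov_symm_rel
  left_inv := by
    rintro ⟨p⟩
    exact congrArg torusProj (torusAnosov.symm_apply_apply p)
  right_inv := by
    rintro ⟨p⟩
    exact congrArg torusProj (torusAnosov.apply_symm_apply p)
  continuous_toFun := torusAnosov.continuous.quotient_map' torusAnosov_rel
  continuous_invFun := torusAnosov.symm.continuous.quotient_map' torusAnosov_symm_rel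

/-- The defining relation `f ∘ π = π ∘ f̃`. -/
theorem sphereMap_torusProj (p : Torus) :
    sphereMap (torusProj p) = torusProj (2 • p.1 + p.2, p.1 + p.2) := rfl

/-! Nearby points of the quotient have lifts that are close up to sign, so every component of the
preimage of a stable (unstable) continuum lies in a short stable (unstable) segment, and it still
projects onto the continuum (`exists_mem_connectedComponentIn_torusProj_eq`). Fix a common point
`π(p)` of a stable and an unstable continuum. Any other common point has a lift `q` with `q - p`
stable, and `q` or `-q` has unstable displacement from `p`. Transversality excludes `q`, so `-q - p`
is unstable. The two displacements then sum to `-2p` in the torus, which fixes both of them, so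
there is at most one such point.

For the sphere, `pillowMap` separates exactly the pairs `{p, -p}`. Its image meets each ray from the
origin once, so radial projection is a bijection onto the sphere. -/

/-! ### The quotient map and lifts of continua. -/

theorem continuous_torusProj : Continuous torusProj := continuous_quotient_mk'

theorem torusProj_eq_iff {p q : Torus} : torusProj p = torusProj q ↔ q = p ∨ q = -p :=
  Quotient.eq (r := negSetoid)

theorem torusProj_surjective : Function.Surjective torusProj := Quotient.mk_surjective

theorem torusProj_neg (p : Torus) : torusProj (-p) = torusProj p :=
  torusProj_eq_iff.2 (Or.inr (neg_neg p).symm)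

theorem isClosedMap_torusProj : IsClosedMap torusProj := by
  intro F hF
  have hq : IsQuotientMap torusProj := isQuotientMap_quotient_mk'
  rw [← hq.isClosed_preimage]
  have h : torusProj ⁻¹' (torusProj '' F) = F ∪ (fun p => -p) ⁻¹' F := by
    ext q
    constructor
    · rintro ⟨p, hp, hpq⟩
      rcases torusProj_eq_iff.1 hpq with rfl | rfl
      · exact Or.inl hp
      · exact Or.inr (by simpa using hp)
    · rintro (h | h)
      · exact ⟨q, h, rfl⟩
      · exact ⟨-q, h, torusProj_neg q⟩
  rw [h]
  exact hF.union (hF.preimage continuous_neg)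

/-- Each component of the preimage of a continuum of the quotient projects onto the continuum. -/
theorem exists_mem_connectedComponentIn_torusProj_eq {A : Set TorusModNeg} (hA : IsClosed A)
    (hc : IsPreconnected A) {p : Torus} (hp : torusProj p ∈ A) {b : TorusModNeg} (hb : b ∈ A) :
    ∃ q ∈ connectedComponentIn (torusProj ⁻¹' A) p, torusProj q = b := by
  set P := torusProj ⁻¹' A with hP
  have hPc : IsClosed P := hA.preimage continuous_torusProj
  have : CompactSpace P := isCompact_iff_compactSpace.1 hPc.isCompact
  have hneg : ∀ r ∈ P, -r ∈ P := fun r hr => by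
    simpa only [hP, Set.mem_preimage, torusProj_neg] using hr
  obtain ⟨q, rfl⟩ := torusProj_surjective b
  by_contra! hcon
  -- In a compact Hausdorff space a component is the intersection of the clopen sets containing it.
  have hsep : ∀ r : P, torusProj r = torusProj q →
      ∃ U : Set P, IsClopen U ∧ (⟨p, hp⟩ : P) ∈ U ∧ r ∉ U := by
    intro r hr
    by_contra! h
    refine hcon r ?_ hr
    rw [connectedComponentIn_eq_image (show p ∈ P from hp)]
    refine ⟨r, ?_, rfl⟩
    rw [connectedComponent_eq_iInter_isClopen, Set.mem_iInter]
    exact fun s => h s.1 s.2.1 s.2.2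
  obtain ⟨U, hU, hpU, hqU⟩ := hsep ⟨q, hb⟩ rfl
  obtain ⟨V, hV, hpV, hqV⟩ := hsep ⟨-q, hneg q hb⟩ (torusProj_neg q)
  set W := U ∩ V
  have hW : IsClopen W := hU.inter hV
  set K : Set Torus := Subtype.val '' W
  set L : Set Torus := Subtype.val '' Wᶜ
  have hK : IsClosed K := hPc.isClosedMap_subtype_val _ hW.1
  have hL : IsClosed L := hPc.isClosedMap_subtype_val _ hW.compl.1
  have hKL : ∀ r ∈ P, r ∈ K ∨ r ∈ L := fun r hr => by
    by_cases h : (⟨r, hr⟩ : P) ∈ W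
    · exact Or.inl ⟨_, h, rfl⟩
    · exact Or.inr ⟨_, h, rfl⟩
  have hdisj : ∀ r, r ∈ K → r ∉ L := by
    rintro _ ⟨r, hr, rfl⟩ ⟨s, hs, hsr⟩
    exact hs (Subtype.ext hsr ▸ hr)
  -- `L` is intersected with `-L` so that no point of it is, even up to sign, in `K`; the two images
  -- are then disjoint closed sets covering `A`.
  obtain ⟨c, -, ⟨r, hr, rfl⟩, s, hs, hrs⟩ := isPreconnected_closed_iff.1 hc
    (torusProj '' K) (torusProj '' (L ∩ (fun r => -r) ⁻¹' L))
    (isClosedMap_torusProj _ hK)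
    (isClosedMap_torusProj _ (hL.inter (hL.preimage continuous_neg)))
    (by
      intro c hcA
      obtain ⟨r, rfl⟩ := torusProj_surjective c
      rcases hKL r hcA with h | h
      · exact Or.inl ⟨r, h, rfl⟩
      · rcases hKL (-r) (hneg r hcA) with h' | h'
        · exact Or.inl ⟨-r, h', torusProj_neg r⟩
        · exact Or.inr ⟨r, ⟨h, h'⟩, rfl⟩)
    ⟨torusProj p, hp, p, ⟨_, ⟨hpU, hpV⟩, rfl⟩, rfl⟩
    ⟨torusProj q, hb, q, ⟨⟨⟨q, hb⟩, fun h => hqU h.1, rfl⟩,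
      ⟨⟨-q, hneg q hb⟩, fun h => hqV h.2, rfl⟩⟩, rfl⟩
  rcases torusProj_eq_iff.1 hrs with rfl | rfl
  · exact hdisj _ hr hs.1
  · exact hdisj _ hr hs.2

/-! ### Linear displacements and hyperbolicity. -/

/-- The covering projection of the plane onto the torus. -/
def planeProj (z : ℝ × ℝ) : Torus := ((z.1 : UnitAddCircle), (z.2 : UnitAddCircle))

theorem planeProj_sub (z w : ℝ × ℝ) : planeProj (z - w) = planeProj z - planeProj w := rfl

theorem norm_planeProj {z : ℝ × ℝ} (hz : ‖z‖ ≤ 1 / 2) : ‖planeProj z‖ = ‖z‖ := by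
  have h1 := (norm_fst_le z).trans hz
  have h2 := (norm_snd_le z).trans hz
  rw [Real.norm_eq_abs] at h1 h2
  rw [Prod.norm_def, Prod.norm_def, Real.norm_eq_abs, Real.norm_eq_abs]
  congr 1
  · exact (AddCircle.norm_coe_eq_abs_iff 1 one_ne_zero).2 (by simpa using h1)
  · exact (AddCircle.norm_coe_eq_abs_iff 1 one_ne_zero).2 (by simpa using h2)

theorem eq_zero_of_planeProj_eq_zero {z : ℝ × ℝ} (hz : ‖z‖ ≤ 1 / 2) (h : planeProj z = 0) :
    z = 0 := by
  rw [← norm_eq_zero, ← norm_planeProj hz, h, norm_zero]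

theorem exists_planeProj_eq (t : Torus) : ∃ z, planeProj z = t ∧ ‖z‖ = ‖t‖ := by
  have h : ∀ s : UnitAddCircle, ∃ x : ℝ, (x : UnitAddCircle) = s ∧ |x| = ‖s‖ := by
    intro s
    obtain ⟨x, rfl⟩ := QuotientAddGroup.mk_surjective s
    refine ⟨x - round x, ?_, UnitAddCircle.norm_eq.symm⟩
    rw [AddCircle.coe_sub, sub_eq_self, AddCircle.coe_eq_zero_iff]
    exact ⟨round x, by simp⟩
  obtain ⟨x, hx, hx'⟩ := h t.1
  obtain ⟨y, hy, hy'⟩ := h t.2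
  exact ⟨(x, y), Prod.ext hx hy, by rw [Prod.norm_def, Prod.norm_def, ← hx', ← hy']; rfl⟩

/-- If a linear functional is expanded by the lift of a toral map, it vanishes on small lifts of
differences of points whose forward orbits stay close. -/
theorem functional_eq_zero_of_orbits_close {g : Torus → Torus} {G : ℝ × ℝ → ℝ × ℝ}
    {l : ℝ × ℝ → ℝ} {a : ℝ} (ha : 1 < a) (hG : ∀ z, ‖G z‖ ≤ 3 * ‖z‖)
    (hgG : ∀ p q z, q - p = planeProj z → g q - g p = planeProj (G z))
    (hl : ∀ z, l (G z) = a * l z) (hl' : ∀ z, |l z| ≤ 3 * ‖z‖)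
    {p q : Torus} (h : ∀ n, ‖g^[n] q - g^[n] p‖ ≤ 1 / 8) {z : ℝ × ℝ}
    (hz : q - p = planeProj z) (hz' : ‖z‖ ≤ 1 / 8) : l z = 0 := by
  have key : ∀ n : ℕ, ∀ p q z, (∀ n, ‖g^[n] q - g^[n] p‖ ≤ 1 / 8) → q - p = planeProj z →
      ‖z‖ ≤ 1 / 8 → a ^ n * |l z| ≤ 1 := by
    intro n
    induction n with
    | zero =>
      intro p q z _ _ hz'
      linarith [hl' z, pow_zero a, one_mul |l z|]
    | succ n ih =>
      intro p q z h hz hz'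
      have h1 := hgG p q z hz
      -- A priori `‖G z‖ ≤ 3/8 ≤ 1/2`, where `planeProj` preserves norms, so closeness of the orbits
      -- restores the bound `1/8`.
      have h2 : ‖G z‖ ≤ 1 / 8 := by
        rw [← norm_planeProj ((hG z).trans (by linarith)), ← h1]
        exact h 1
      have h3 := ih (g p) (g q) (G z) (fun n => h (n + 1)) h1 h2
      rwa [hl, abs_mul, abs_of_pos (by linarith), ← mul_assoc, ← pow_succ] at h3
  by_contra hne
  have hpos : 0 < |l z| := abs_pos.2 hne
  obtain ⟨n, hn⟩ := pow_unbounded_of_one_lt (1 / |l z|) ha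
  rw [div_lt_iff₀ hpos] at hn
  exact absurd (key n p q z h hz hz') (not_le.2 hn)

open Real in
-- `(φ, 1)` is a left eigenvector of the matrix for the eigenvalue `φ²`; its kernel is the stable
-- line.
theorem stable_functional_eq_zero {p q : Torus}
    (h : ∀ n, ‖torusAnosov^[n] q - torusAnosov^[n] p‖ ≤ 1 / 8) {z : ℝ × ℝ}
    (hz : q - p = planeProj z) (hz' : ‖z‖ ≤ 1 / 8) : goldenRatio * z.1 + z.2 = 0 := by
  refine functional_eq_zero_of_orbits_close (g := torusAnosov) (a := goldenRatio ^ 2)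
    (G := fun z => (2 * z.1 + z.2, z.1 + z.2)) (l := fun z => goldenRatio * z.1 + z.2)
    (one_lt_pow₀ one_lt_goldenRatio two_ne_zero) ?_ ?_ ?_ ?_ h hz hz'
  · intro z
    have h1 := abs_le.1 (norm_fst_le z)
    have h2 := abs_le.1 (norm_snd_le z)
    refine max_le (abs_le.2 ⟨?_, ?_⟩) (abs_le.2 ⟨?_, ?_⟩) <;> simp only <;> linarith [norm_nonneg z]
  · intro p q z hz
    have h1 : (z.1 : UnitAddCircle) = q.1 - p.1 := (congrArg Prod.fst hz).symm
    have h2 : (z.2 : UnitAddCircle) = q.2 - p.2 := (congrArg Prod.snd hz).symm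
    refine Prod.ext ?_ ?_
    · change 2 • q.1 + q.2 - (2 • p.1 + p.2) = ((2 * z.1 + z.2 : ℝ) : UnitAddCircle)
      rw [two_mul, AddCircle.coe_add, AddCircle.coe_add, h1, h2]
      abel
    · change q.1 + q.2 - (p.1 + p.2) = ((z.1 + z.2 : ℝ) : UnitAddCircle)
      rw [AddCircle.coe_add, h1, h2]
      abel
  · intro z
    linear_combination (-(goldenRatio + 1) * z.1 - z.2) * goldenRatio_sq
  · intro z
    have h1 : |z.1| ≤ ‖z‖ := norm_fst_le z
    have h2 : |z.2| ≤ ‖z‖ := norm_snd_le z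
    have h3 := goldenRatio_lt_two
    have h4 := goldenRatio_pos
    calc |goldenRatio * z.1 + z.2| ≤ |goldenRatio * z.1| + |z.2| := abs_add_le _ _
      _ = goldenRatio * |z.1| + |z.2| := by rw [abs_mul, abs_of_pos h4]
      _ ≤ 3 * ‖z‖ := by nlinarith [abs_nonneg z.1]

open Real in
-- `(1, -φ)` is a left eigenvector of the inverse matrix for `φ²`; its kernel is the unstable line.
theorem unstable_functional_eq_zero {p q : Torus}
    (h : ∀ n, ‖torusAnosov.symm^[n] q - torusAnosov.symm^[n] p‖ ≤ 1 / 8) {z : ℝ × ℝ}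
    (hz : q - p = planeProj z) (hz' : ‖z‖ ≤ 1 / 8) : z.1 - goldenRatio * z.2 = 0 := by
  refine functional_eq_zero_of_orbits_close (g := torusAnosov.symm) (a := goldenRatio ^ 2)
    (G := fun z => (z.1 - z.2, 2 * z.2 - z.1)) (l := fun z => z.1 - goldenRatio * z.2)
    (one_lt_pow₀ one_lt_goldenRatio two_ne_zero) ?_ ?_ ?_ ?_ h hz hz'
  · intro z
    have h1 := abs_le.1 (norm_fst_le z)
    have h2 := abs_le.1 (norm_snd_le z)
    refine max_le (abs_le.2 ⟨?_, ?_⟩) (abs_le.2 ⟨?_, ?_⟩) <;> simp only <;> linarith [norm_nonneg z]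
  · intro p q z hz
    have h1 : (z.1 : UnitAddCircle) = q.1 - p.1 := (congrArg Prod.fst hz).symm
    have h2 : (z.2 : UnitAddCircle) = q.2 - p.2 := (congrArg Prod.snd hz).symm
    refine Prod.ext ?_ ?_
    · change q.1 - q.2 - (p.1 - p.2) = ((z.1 - z.2 : ℝ) : UnitAddCircle)
      rw [AddCircle.coe_sub, h1, h2]
      abel
    · change 2 • q.2 - q.1 - (2 • p.2 - p.1) = ((2 * z.2 - z.1 : ℝ) : UnitAddCircle)
      rw [two_mul, AddCircle.coe_sub, AddCircle.coe_add, h1, h2]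
      abel
  · intro z
    linear_combination (-z.1 + (goldenRatio + 1) * z.2) * goldenRatio_sq
  · intro z
    have h1 : |z.1| ≤ ‖z‖ := norm_fst_le z
    have h2 : |z.2| ≤ ‖z‖ := norm_snd_le z
    have h3 := goldenRatio_lt_two
    have h4 := goldenRatio_pos
    calc |z.1 - goldenRatio * z.2| ≤ |z.1| + |goldenRatio * z.2| := abs_sub _ _
      _ = |z.1| + goldenRatio * |z.2| := by rw [abs_mul, abs_of_pos h4]
      _ ≤ 3 * ‖z‖ := by nlinarith [abs_nonneg z.2]

/-! ### Closeness of lifted orbits and cw2-expansivity. -/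

/-- A continuum through `p` contained in two small balls around `p` and `-p` is small. -/
theorem norm_sub_le_of_isPreconnected {C : Set Torus} (hC : IsPreconnected C) {p : Torus}
    (hp : p ∈ C) {ε : ℝ} (hε : 0 ≤ ε) (h : ∀ q ∈ C, ‖q - p‖ ≤ ε ∨ ‖q + p‖ ≤ ε) :
    ∀ q ∈ C, ‖q - p‖ ≤ 3 * ε := by
  intro q hq
  rcases h q hq with h1 | h1
  · linarith
  -- If both balls are needed, connectedness gives a point `r` in both, which links `q` to `p` in
  -- three steps.
  obtain ⟨r, -, hr1, hr2⟩ := isPreconnected_closed_iff.1 hC {q | ‖q - p‖ ≤ ε} {q | ‖q + p‖ ≤ ε}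
    (isClosed_le (by fun_prop) (by fun_prop)) (isClosed_le (by fun_prop) (by fun_prop)) h
    ⟨p, hp, by simpa using hε⟩ ⟨q, hq, h1⟩
  have h2 : q - p = (q + p) + (r - p) - (r + p) := by abel
  rw [h2]
  have h3 := norm_sub_le ((q + p) + (r - p)) (r + p)
  have h4 := norm_add_le (q + p) (r - p)
  change ‖r - p‖ ≤ ε at hr1
  change ‖r + p‖ ≤ ε at hr2
  linarith

/-- Lifting a stable continuum: in a component of its preimage, orbits stay close. -/
theorem orbits_close_of_mem_connectedComponentIn {g : Torus → Torus} (hg : Continuous g)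
    {f : TorusModNeg → TorusModNeg} (hgf : Function.Semiconj torusProj g f)
    {A : Set TorusModNeg} {ε : ℝ} (hε : 0 ≤ ε)
    (h : ∀ n, ∀ p q, torusProj p ∈ f^[n] '' A → torusProj q ∈ f^[n] '' A →
      ‖q - p‖ ≤ ε ∨ ‖q + p‖ ≤ ε) {p q : Torus} (hp : torusProj p ∈ A)
    (hq : q ∈ connectedComponentIn (torusProj ⁻¹' A) p) (n : ℕ) :
    ‖g^[n] q - g^[n] p‖ ≤ 3 * ε := by
  have hmem : ∀ r, torusProj r ∈ A → torusProj (g^[n] r) ∈ f^[n] '' A := fun r hr =>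
    ⟨_, hr, ((hgf.iterate_right n).eq r).symm⟩
  refine norm_sub_le_of_isPreconnected
    (isPreconnected_connectedComponentIn.image _ (hg.iterate n).continuousOn)
    ⟨p, mem_connectedComponentIn hp, rfl⟩ hε ?_ _ ⟨q, hq, rfl⟩
  rintro _ ⟨r, hr, rfl⟩
  exact h n _ _ (hmem p hp) (hmem r (connectedComponentIn_subset (torusProj ⁻¹' A) p hr))

/-- Points of the quotient that are close have close lifts, up to sign. -/
theorem exists_dist_le_imp_norm_le (m : MetricSpace TorusModNeg)
    (hm : (instTopologicalSpaceQuotient : TopologicalSpace TorusModNeg) =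
      m.toPseudoMetricSpace.toUniformSpace.toTopologicalSpace) {ε : ℝ} (hε : 0 < ε) :
    ∃ δ > 0, ∀ p q : Torus, m.dist (torusProj p) (torusProj q) ≤ δ →
      ‖q - p‖ ≤ ε ∨ ‖q + p‖ ≤ ε := by
  have hcont : Continuous fun x : Torus × Torus => m.dist (torusProj x.1) (torusProj x.2) := by
    let _ := m.replaceTopology hm
    exact (continuous_torusProj.comp continuous_fst).dist (continuous_torusProj.comp continuous_snd)
  -- On this compact set the projections differ, so their distance has a positive lower bound.
  have hK : IsCompact {x : Torus × Torus | ε ≤ ‖x.2 - x.1‖ ∧ ε ≤ ‖x.2 + x.1‖} :=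
    ((isClosed_le (f := fun _ => ε) (g := fun x : Torus × Torus => ‖x.2 - x.1‖)
      (by fun_prop) (by fun_prop)).inter
      (isClosed_le (f := fun _ => ε) (g := fun x : Torus × Torus => ‖x.2 + x.1‖)
      (by fun_prop) (by fun_prop))).isCompact
  obtain ⟨δ, hδ, h⟩ := hK.exists_forall_le' hcont.continuousOn (a := 0) (by
    rintro ⟨p, q⟩ ⟨h1, h2⟩
    refine lt_of_le_of_ne (@dist_nonneg _ m.toPseudoMetricSpace _ _) fun h0 => ?_
    simp only at h0 h1 h2
    rcases torusProj_eq_iff.1 (m.eq_of_dist_eq_zero h0.symm) with rfl | rfl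
    · rw [sub_self, norm_zero] at h1
      linarith
    · rw [neg_add_cancel, norm_zero] at h2
      linarith)
  refine ⟨δ / 2, by linarith, fun p q hpq => ?_⟩
  by_contra! hcon
  have := h (p, q) ⟨hcon.1.le, hcon.2.le⟩
  simp only at this
  linarith

theorem semiconj_torusAnosov : Function.Semiconj torusProj torusAnosov sphereMap := fun _ => rfl

theorem semiconj_torusAnosov_symm :
    Function.Semiconj torusProj torusAnosov.symm sphereMap.symm := fun _ => rfl

/-- A displacement is determined by its stable and unstable coordinates. -/
theorem eq_of_functionals_eq_zero {u v : ℝ × ℝ}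
    (hu : Real.goldenRatio * u.1 + u.2 = 0) (hv : v.1 - Real.goldenRatio * v.2 = 0)
    (huv : u = v) : u = 0 := by
  subst huv
  have h1 : (Real.goldenRatio ^ 2 + 1) * u.2 = 0 := by linear_combination hu - Real.goldenRatio * hv
  have h2 : u.2 = 0 := (mul_eq_zero.1 h1).resolve_left (by positivity)
  have h3 : u.1 = 0 := by simpa [h2] using hv
  exact Prod.ext h3 h2

theorem Homeomorph.coe_pow_eq_iterate {X : Type*} [TopologicalSpace X] (f : X ≃ₜ X) (n : ℕ) :
    ⇑(f ^ n) = f^[n] := by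
  induction n with
  | zero => rfl
  | succ n ih =>
    rw [pow_succ, Function.iterate_succ, ← ih]
    rfl

theorem isCwExpansive_sphereMap (m : MetricSpace TorusModNeg)
    (hm : (instTopologicalSpaceQuotient : TopologicalSpace TorusModNeg) =
      m.toPseudoMetricSpace.toUniformSpace.toTopologicalSpace) :
    @IsCwExpansive TorusModNeg (m.replaceTopology hm) 2 sphereMap := by
  -- Lifting costs a factor 3, giving displacements of norm at most `1/8`; four of these still sum
  -- to at most `1/2`.
  obtain ⟨δ, hδ, hclose⟩ := exists_dist_le_imp_norm_le m hm (ε := 1 / 24) (by norm_num)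
  let _ := m.replaceTopology hm
  refine ⟨δ, hδ, fun A hA B hB => ?_⟩
  have hsmall : ∀ D ∈ smallContinua TorusModNeg δ, ∀ p q, torusProj p ∈ D → torusProj q ∈ D →
      ‖q - p‖ ≤ 1 / 24 ∨ ‖q + p‖ ≤ 1 / 24 := fun D hD p q hp hq =>
    hclose p q ((Metric.dist_le_diam_of_mem hD.1.1.isBounded hp hq).trans hD.2)
  have hAsmall := fun n : ℕ => hsmall _ (hA.2 n (Int.natCast_nonneg n))
  have hBsmall := fun n : ℕ => hsmall _ (hB.2 (-n) (by simp))
  simp only [zpow_natCast, zpow_neg, ← inv_pow, Homeomorph.coe_pow_eq_iterate] at hAsmall hBsmall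
  have hst : ∀ p q, torusProj p ∈ A → q ∈ connectedComponentIn (torusProj ⁻¹' A) p →
      ∃ z, q - p = planeProj z ∧ ‖z‖ ≤ 1 / 8 ∧ Real.goldenRatio * z.1 + z.2 = 0 := by
    intro p q hp hq
    have h := fun n => (orbits_close_of_mem_connectedComponentIn torusAnosov.continuous
      semiconj_torusAnosov (by norm_num) hAsmall hp hq n).trans (by norm_num : _ ≤ (1 / 8 : ℝ))
    obtain ⟨z, hz, hz'⟩ := exists_planeProj_eq (q - p)
    have hz8 : ‖z‖ ≤ 1 / 8 := hz' ▸ h 0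
    exact ⟨z, hz.symm, hz8, stable_functional_eq_zero h hz.symm hz8⟩
  have hun : ∀ p q, torusProj p ∈ B → q ∈ connectedComponentIn (torusProj ⁻¹' B) p →
      ∃ z, q - p = planeProj z ∧ ‖z‖ ≤ 1 / 8 ∧ z.1 - Real.goldenRatio * z.2 = 0 := by
    intro p q hp hq
    have h := fun n => (orbits_close_of_mem_connectedComponentIn torusAnosov.symm.continuous
      semiconj_torusAnosov_symm (by norm_num) hBsmall hp hq n).trans
      (by norm_num : _ ≤ (1 / 8 : ℝ))
    obtain ⟨z, hz, hz'⟩ := exists_planeProj_eq (q - p)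
    have hz8 : ‖z‖ ≤ 1 / 8 := hz' ▸ h 0
    exact ⟨z, hz.symm, hz8, unstable_functional_eq_zero h hz.symm hz8⟩
  rcases (A ∩ B).eq_empty_or_nonempty with h0 | ⟨a, haA, haB⟩
  · simp [h0]
  obtain ⟨p, rfl⟩ := torusProj_surjective a
  have hother : ∀ b ∈ A ∩ B, b ≠ torusProj p → ∃ q z w, torusProj q = b ∧
      q - p = planeProj z ∧ ‖z‖ ≤ 1 / 8 ∧ Real.goldenRatio * z.1 + z.2 = 0 ∧
      -q - p = planeProj w ∧ ‖w‖ ≤ 1 / 8 ∧ w.1 - Real.goldenRatio * w.2 = 0 := by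
    rintro b ⟨hbA, hbB⟩ hne
    obtain ⟨q, hq, rfl⟩ := exists_mem_connectedComponentIn_torusProj_eq hA.1.1.isClosed
      hA.1.2.isPreconnected haA hbA
    obtain ⟨r, hr, hrq⟩ := exists_mem_connectedComponentIn_torusProj_eq hB.1.1.isClosed
      hB.1.2.isPreconnected haB hbB
    obtain ⟨z, hz, hz8, hz0⟩ := hst p q haA hq
    obtain ⟨w, hw, hw8, hw0⟩ := hun p r haB hr
    rcases torusProj_eq_iff.1 hrq.symm with rfl | rfl
    · exfalso
      have h1 : z - w = 0 := by
        refine eq_zero_of_planeProj_eq_zero ((norm_sub_le z w).trans (by linarith)) ?_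
        rw [planeProj_sub, ← hz, ← hw, sub_self]
      have h2 := eq_of_functionals_eq_zero hz0 hw0 (sub_eq_zero.1 h1)
      rw [h2] at hz
      exact hne (congrArg torusProj (sub_eq_zero.1 hz))
    · exact ⟨q, z, w, rfl, hz, hz8, hz0, hw, hw8, hw0⟩
  have huniq : ∀ b ∈ A ∩ B, ∀ c ∈ A ∩ B, b ≠ torusProj p → c ≠ torusProj p → b = c := by
    intro b hb c hc hbp hcp
    obtain ⟨q, z, w, rfl, hz, hz8, hz0, hw, hw8, hw0⟩ := hother b hb hbp
    obtain ⟨q', z', w', rfl, hz', hz8', hz0', hw', hw8', hw0'⟩ := hother c hc hcp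
    -- Both `z + w` and `z' + w'` project to `-2p`, so `z - z' = w' - w` is both stable and
    -- unstable.
    have h1 : (z - z') - (w' - w) = 0 := by
      refine eq_zero_of_planeProj_eq_zero ?_ ?_
      · have h1 := norm_sub_le (z - z') (w' - w)
        have h2 := norm_sub_le z z'
        have h3 := norm_sub_le w' w
        linarith
      · simp only [planeProj_sub, ← hz, ← hz', ← hw, ← hw']
        abel
    have h2 : z - z' = 0 := eq_of_functionals_eq_zero (v := w' - w)
      (by simp only [Prod.fst_sub, Prod.snd_sub]; linear_combination hz0 - hz0')
      (by simp only [Prod.fst_sub, Prod.snd_sub]; linear_combination hw0' - hw0)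
      (sub_eq_zero.1 h1)
    rw [sub_eq_zero.1 h2, ← hz'] at hz
    rw [sub_left_injective hz]
  by_cases h : ∃ b ∈ A ∩ B, b ≠ torusProj p
  · obtain ⟨b, hb, hbp⟩ := h
    refine (Set.encard_le_encard (t := {torusProj p, b}) fun c hc => ?_).trans
      ?_
    · by_cases hcp : c = torusProj p
      · exact Or.inl hcp
      · exact Or.inr (huniq c hc b hb hcp hbp)
    · rw [Set.encard_pair hbp.symm]
      rfl
  · push Not at h
    refine (Set.encard_le_encard (t := {torusProj p}) h).trans ?_
    rw [Set.encard_singleton]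
    exact one_le_two

/-! ### The pillow and the sphere. -/

/-- The map `(x, y) ↦ (cos 2πx, cos 2πy, sin 2πx sin 2πy)`, which embeds `T² / (p ∼ -p)` as a
pillow that is star-shaped about the origin. -/
noncomputable def pillowMap (p : Torus) : EuclideanSpace ℝ (Fin 3) :=
  !₂[(p.1.toCircle : ℂ).re, (p.2.toCircle : ℂ).re,
    (p.1.toCircle : ℂ).im * (p.2.toCircle : ℂ).im]

theorem continuous_pillowMap : Continuous pillowMap := by
  have h : Continuous fun x : UnitAddCircle => (x.toCircle : ℂ) :=
    continuous_subtype_val.comp AddCircle.continuous_toCircle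
  have h1 : Continuous fun p : Torus => (p.1.toCircle : ℂ) := h.comp continuous_fst
  have h2 : Continuous fun p : Torus => (p.2.toCircle : ℂ) := h.comp continuous_snd
  refine (PiLp.continuous_toLp 2 _).comp (continuous_pi fun i => ?_)
  fin_cases i
  · exact Complex.continuous_re.comp h1
  · exact Complex.continuous_re.comp h2
  · exact (Complex.continuous_im.comp h1).mul (Complex.continuous_im.comp h2)

theorem Circle.re_sq_add_im_sq (z : Circle) : (z : ℂ).re ^ 2 + (z : ℂ).im ^ 2 = 1 := by
  have h := Circle.normSq_coe z
  rw [Complex.normSq_apply] at h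
  linarith

theorem toCircle_neg_re (x : UnitAddCircle) :
    ((-x).toCircle : ℂ).re = (x.toCircle : ℂ).re := by
  rw [AddCircle.toCircle_neg, Circle.coe_inv_eq_conj, Complex.conj_re]

theorem toCircle_neg_im (x : UnitAddCircle) :
    ((-x).toCircle : ℂ).im = -(x.toCircle : ℂ).im := by
  rw [AddCircle.toCircle_neg, Circle.coe_inv_eq_conj, Complex.conj_im]

theorem eq_of_toCircle {x y : UnitAddCircle} (h : (x.toCircle : ℂ).re = (y.toCircle : ℂ).re)
    (h' : (x.toCircle : ℂ).im = (y.toCircle : ℂ).im) : x = y :=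
  AddCircle.injective_toCircle one_ne_zero (Circle.ext (Complex.ext h h'))

theorem eq_or_eq_neg_of_toCircle_re {x y : UnitAddCircle}
    (h : (x.toCircle : ℂ).re = (y.toCircle : ℂ).re) : y = x ∨ y = -x := by
  have h1 := Circle.re_sq_add_im_sq x.toCircle
  have h2 := Circle.re_sq_add_im_sq y.toCircle
  rw [h] at h1
  rcases sq_eq_sq_iff_eq_or_eq_neg.1 (by linarith : (y.toCircle : ℂ).im ^ 2 = (x.toCircle : ℂ).im ^ 2) with h3 | h3
  · exact Or.inl (eq_of_toCircle h.symm h3)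
  · exact Or.inr (eq_of_toCircle (by rw [toCircle_neg_re, h]) (by rw [toCircle_neg_im, h3]))

theorem exists_toCircle {a b : ℝ} (h : a ^ 2 + b ^ 2 = 1) :
    ∃ x : UnitAddCircle, (x.toCircle : ℂ).re = a ∧ (x.toCircle : ℂ).im = b := by
  have hmem : (⟨a, b⟩ : ℂ) ∈ Submonoid.unitSphere ℂ := by
    change _ ∈ Metric.sphere (0 : ℂ) 1
    rw [mem_sphere_zero_iff_norm, Complex.norm_eq_sqrt_sq_add_sq, h, Real.sqrt_one]
  obtain ⟨x, hx⟩ := (AddCircle.homeomorphCircle (one_ne_zero (α := ℝ))).surjective ⟨_, hmem⟩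
  rw [AddCircle.homeomorphCircle_apply] at hx
  exact ⟨x, by rw [hx], by rw [hx]⟩

theorem pillowMap_neg (p : Torus) : pillowMap (-p) = pillowMap p := by
  simp [pillowMap, toCircle_neg_re, toCircle_neg_im]

theorem eq_or_eq_neg_of_pillowMap_eq {p q : Torus} (h : pillowMap p = pillowMap q) :
    q = p ∨ q = -p := by
  have h0 := congrArg (fun v : EuclideanSpace ℝ (Fin 3) => v 0) h
  have h1 := congrArg (fun v : EuclideanSpace ℝ (Fin 3) => v 1) h
  have h2 := congrArg (fun v : EuclideanSpace ℝ (Fin 3) => v 2) h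
  obtain ⟨x, y⟩ := p
  obtain ⟨x', y'⟩ := q
  simp only [pillowMap, PiLp.toLp_apply, Matrix.cons_val] at h0 h1 h2
  have hz : ∀ t : UnitAddCircle, (t.toCircle : ℂ).im = 0 → -t = t := fun t ht =>
    eq_of_toCircle (toCircle_neg_re t) (by rw [toCircle_neg_im, ht, neg_zero])
  -- The cosines fix each coordinate up to sign. If the signs differ, the third coordinate forces
  -- one sine to vanish, and that coordinate is its own negative.
  rcases eq_or_eq_neg_of_toCircle_re h0 with rfl | rfl <;>
    rcases eq_or_eq_neg_of_toCircle_re h1 with rfl | rfl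
  · exact Or.inl rfl
  · rw [toCircle_neg_im] at h2
    rcases mul_eq_zero.1 (by linarith : (x'.toCircle : ℂ).im * (y.toCircle : ℂ).im = 0) with h | h
    · exact Or.inr (Prod.ext (hz _ h).symm rfl)
    · exact Or.inl (Prod.ext rfl (hz _ h))
  · rw [toCircle_neg_im] at h2
    rcases mul_eq_zero.1 (by linarith : (x.toCircle : ℂ).im * (y'.toCircle : ℂ).im = 0) with h | h
    · exact Or.inl (Prod.ext (hz _ h) rfl)
    · exact Or.inr (Prod.ext rfl (hz _ h).symm)
  · exact Or.inr rfl

theorem pillowMap_equation (p : Torus) : pillowMap p 0 ^ 2 ≤ 1 ∧ pillowMap p 1 ^ 2 ≤ 1 ∧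
    pillowMap p 2 ^ 2 = (1 - pillowMap p 0 ^ 2) * (1 - pillowMap p 1 ^ 2) := by
  have h1 := Circle.re_sq_add_im_sq p.1.toCircle
  have h2 := Circle.re_sq_add_im_sq p.2.toCircle
  simp only [pillowMap, PiLp.toLp_apply, Matrix.cons_val]
  refine ⟨by nlinarith [sq_nonneg (p.1.toCircle : ℂ).im],
    by nlinarith [sq_nonneg (p.2.toCircle : ℂ).im], ?_⟩
  rw [mul_pow, ← eq_sub_iff_add_eq'.2 h1, ← eq_sub_iff_add_eq'.2 h2]

theorem exists_pillowMap_eq {v : EuclideanSpace ℝ (Fin 3)} (h0 : v 0 ^ 2 ≤ 1) (h1 : v 1 ^ 2 ≤ 1)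
    (h : v 2 ^ 2 = (1 - v 0 ^ 2) * (1 - v 1 ^ 2)) : ∃ p, pillowMap p = v := by
  have hs : ∃ s t : ℝ, v 0 ^ 2 + s ^ 2 = 1 ∧ v 1 ^ 2 + t ^ 2 = 1 ∧ s * t = v 2 := by
    have hs0 := Real.sq_sqrt (sub_nonneg.2 h0)
    have hs1 := Real.sq_sqrt (sub_nonneg.2 h1)
    have hs : v 2 ^ 2 = (√(1 - v 0 ^ 2) * √(1 - v 1 ^ 2)) ^ 2 := by rw [mul_pow, hs0, hs1, h]
    rcases sq_eq_sq_iff_eq_or_eq_neg.1 hs with h2 | h2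
    · exact ⟨√(1 - v 0 ^ 2), √(1 - v 1 ^ 2), by linarith, by linarith, h2.symm⟩
    · exact ⟨-√(1 - v 0 ^ 2), √(1 - v 1 ^ 2), by linarith [neg_sq √(1 - v 0 ^ 2)], by linarith,
        by rw [h2, neg_mul]⟩
  obtain ⟨s, t, hs, ht, hst⟩ := hs
  obtain ⟨x, hx, hx'⟩ := exists_toCircle hs
  obtain ⟨y, hy, hy'⟩ := exists_toCircle ht
  refine ⟨(x, y), ?_⟩
  ext i
  fin_cases i
  · exact hx
  · exact hy
  · change (x.toCircle : ℂ).im * (y.toCircle : ℂ).im = v 2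
    rw [hx', hy', hst]

theorem pillowMap_ne_zero (p : Torus) : pillowMap p ≠ 0 := by
  intro h
  have h1 := (pillowMap_equation p).2.2
  rw [h] at h1
  simp at h1

/-- Each ray from the origin meets the pillow at most once. -/
theorem eq_one_of_pillow_equation {a b c t : ℝ} (ht : 1 ≤ t) (h : c ^ 2 = (1 - a ^ 2) * (1 - b ^ 2))
    (ha : (t * a) ^ 2 ≤ 1) (hb : (t * b) ^ 2 ≤ 1)
    (h' : (t * c) ^ 2 = (1 - (t * a) ^ 2) * (1 - (t * b) ^ 2)) : t = 1 := by
  by_contra hne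
  have hs : 1 < t ^ 2 := one_lt_pow₀ (lt_of_le_of_ne ht (Ne.symm hne)) two_ne_zero
  rw [mul_pow] at ha hb
  rw [mul_pow, mul_pow, mul_pow] at h'
  have ha1 : a ^ 2 ≤ t ^ 2 * a ^ 2 := le_mul_of_one_le_left (sq_nonneg a) hs.le
  have hb1 : b ^ 2 ≤ t ^ 2 * b ^ 2 := le_mul_of_one_le_left (sq_nonneg b) hs.le
  -- Scaling by `t > 1` enlarges the left side of the equation but not the right, so `c = 0`; then
  -- `a² = 1` or `b² = 1`, and scaling leaves the cube.
  have h1 : t ^ 2 * c ^ 2 ≤ c ^ 2 := by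
    rw [h', h]
    exact mul_le_mul (by linarith) (by linarith) (by linarith) (by linarith)
  have hc : c ^ 2 = 0 := le_antisymm (by nlinarith [sq_nonneg c]) (sq_nonneg c)
  rw [hc] at h
  rcases mul_eq_zero.1 h.symm with h2 | h2 <;> nlinarith

/-- Each ray from the origin meets the pillow. -/
theorem exists_pillow_equation {a b c : ℝ} (h : a ^ 2 + b ^ 2 + c ^ 2 = 1) :
    ∃ t > 0, (t * a) ^ 2 ≤ 1 ∧ (t * b) ^ 2 ≤ 1 ∧
      (t * c) ^ 2 = (1 - (t * a) ^ 2) * (1 - (t * b) ^ 2) := by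
  have main : ∀ a b : ℝ, a ^ 2 + b ^ 2 + c ^ 2 = 1 → b ^ 2 ≤ a ^ 2 → ∃ t > 0, (t * a) ^ 2 ≤ 1 ∧
      (t * b) ^ 2 ≤ 1 ∧ (t * c) ^ 2 = (1 - (t * a) ^ 2) * (1 - (t * b) ^ 2) := by
    intro a b h hab
    rcases eq_or_ne a 0 with rfl | ha
    · have hb : b = 0 := by nlinarith [sq_nonneg b]
      subst hb
      exact ⟨1, one_pos, by norm_num, by norm_num, by linarith⟩
    have ha' : 0 < |a| := abs_pos.2 ha
    -- The function is `1` at `0` and nonpositive at `|a|⁻¹`, where the ray leaves the square, since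
    -- `|a|` is the larger of the two.
    obtain ⟨t, ⟨ht0, ht1⟩, ht⟩ := intermediate_value_Icc' (a := 0) (b := |a|⁻¹) (by positivity)
      (f := fun t => (1 - (t * a) ^ 2) * (1 - (t * b) ^ 2) - (t * c) ^ 2)
      (by fun_prop : Continuous _).continuousOn (show (0 : ℝ) ∈ _ from ⟨by
        have : (|a|⁻¹ * a) ^ 2 = 1 := by
          rw [mul_pow, inv_pow, sq_abs, inv_mul_cancel₀ (pow_ne_zero 2 ha)]
        simp only [this]
        nlinarith [sq_nonneg (|a|⁻¹ * c)], by norm_num⟩)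
    have hta : (t * a) ^ 2 ≤ 1 := by
      rw [← sq_abs, abs_mul, abs_of_nonneg ht0]
      refine pow_le_one₀ (by positivity) ?_
      rwa [← le_div_iff₀ ha', one_div]
    refine ⟨t, lt_of_le_of_ne ht0 ?_, hta, ?_, ?_⟩
    · rintro rfl
      norm_num at ht
    · rw [mul_pow] at hta ⊢
      exact (mul_le_mul_of_nonneg_left hab (sq_nonneg t)).trans hta
    · simp only at ht
      linarith
  rcases le_total (b ^ 2) (a ^ 2) with hab | hab
  · exact main a b h hab
  · obtain ⟨t, ht, h1, h2, h3⟩ := main b a (by linarith) hab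
    exact ⟨t, ht, h2, h1, by rw [h3, mul_comm]⟩

theorem pillowMap_eq_of_eq_smul {p q : Torus} {t : ℝ} (ht : 1 ≤ t)
    (h : pillowMap q = t • pillowMap p) : pillowMap q = pillowMap p := by
  obtain ⟨-, -, hp⟩ := pillowMap_equation p
  obtain ⟨hq0, hq1, hq⟩ := pillowMap_equation q
  simp only [h, PiLp.smul_apply, smul_eq_mul] at hq0 hq1 hq
  rw [h, eq_one_of_pillow_equation ht hp hq0 hq1 hq, one_smul]

/-- The radial projection of the pillow to the sphere. -/
noncomputable def spherePillowMap (p : Torus) : Metric.sphere (0 : EuclideanSpace ℝ (Fin 3)) 1 :=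
  ⟨‖pillowMap p‖⁻¹ • pillowMap p, by
    rw [mem_sphere_zero_iff_norm, norm_smul, norm_inv, norm_norm,
      inv_mul_cancel₀ (norm_ne_zero_iff.2 (pillowMap_ne_zero p))]⟩

theorem continuous_spherePillowMap : Continuous spherePillowMap :=
  ((continuous_pillowMap.norm.inv₀ fun p => norm_ne_zero_iff.2 (pillowMap_ne_zero p)).smul
    continuous_pillowMap).subtype_mk _

theorem pillowMap_eq_of_spherePillowMap_eq {p q : Torus}
    (h : spherePillowMap p = spherePillowMap q) : pillowMap p = pillowMap q := by
  have h1 : ‖pillowMap p‖⁻¹ • pillowMap p = ‖pillowMap q‖⁻¹ • pillowMap q :=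
    congrArg Subtype.val h
  have hp := norm_pos_iff.2 (pillowMap_ne_zero p)
  have hq := norm_pos_iff.2 (pillowMap_ne_zero q)
  rcases le_total ‖pillowMap p‖ ‖pillowMap q‖ with hle | hle
  · refine (pillowMap_eq_of_eq_smul (t := ‖pillowMap q‖ * ‖pillowMap p‖⁻¹) ?_ ?_).symm
    · rwa [← div_eq_mul_inv, one_le_div hp]
    · rw [mul_smul, h1, smul_smul, mul_inv_cancel₀ hq.ne', one_smul]
  · refine pillowMap_eq_of_eq_smul (t := ‖pillowMap p‖ * ‖pillowMap q‖⁻¹) ?_ ?_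
    · rwa [← div_eq_mul_inv, one_le_div hq]
    · rw [mul_smul, ← h1, smul_smul, mul_inv_cancel₀ hp.ne', one_smul]

theorem spherePillowMap_surjective : Function.Surjective spherePillowMap := by
  rintro ⟨v, hv⟩
  have hv1 : ‖v‖ = 1 := mem_sphere_zero_iff_norm.1 hv
  have hsum : v 0 ^ 2 + v 1 ^ 2 + v 2 ^ 2 = 1 := by
    have h := EuclideanSpace.real_norm_sq_eq v
    rw [hv1, Fin.sum_univ_three] at h
    linarith
  obtain ⟨t, ht, h0, h1, h2⟩ := exists_pillow_equation hsum
  obtain ⟨p, hp⟩ := exists_pillowMap_eq (v := t • v) h0 h1 h2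
  refine ⟨p, Subtype.ext ?_⟩
  change ‖pillowMap p‖⁻¹ • pillowMap p = v
  rw [hp, norm_smul, hv1, mul_one, Real.norm_of_nonneg ht.le, smul_smul, inv_mul_cancel₀ ht.ne',
    one_smul]

theorem nonempty_homeomorph_sphere :
    Nonempty (TorusModNeg ≃ₜ Metric.sphere (0 : EuclideanSpace ℝ (Fin 3)) 1) := by
  have hrel : ∀ p q : Torus, negSetoid p q → spherePillowMap p = spherePillowMap q := by
    rintro p q (rfl | rfl)
    · rfl
    · simp only [spherePillowMap, pillowMap_neg]
  -- A continuous bijection from a compact space to a Hausdorff space is a homeomorphism.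
  refine ⟨IsHomeomorph.homeomorph (Quotient.lift spherePillowMap hrel)
    (isHomeomorph_iff_continuous_bijective.2
      ⟨continuous_spherePillowMap.quotient_lift hrel, ?_, ?_⟩)⟩
  · rintro ⟨p⟩ ⟨q⟩ h
    exact torusProj_eq_iff.2 (eq_or_eq_neg_of_pillowMap_eq (pillowMap_eq_of_spherePillowMap_eq h))
  · intro v
    obtain ⟨p, hp⟩ := spherePillowMap_surjective v
    exact ⟨torusProj p, hp⟩

/-- The quotient `T² / (p ∼ -p)` is a two-dimensional sphere, and, for every metric inducing its
topology, the homeomorphism induced by `(x, y) ↦ (2x + y, x + y)` is cw2-expansive. -/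
theorem mainTheorem11 :
    Nonempty (TorusModNeg ≃ₜ Metric.sphere (0 : EuclideanSpace ℝ (Fin 3)) 1) ∧
    ∀ (m : MetricSpace TorusModNeg)
      (hm : (instTopologicalSpaceQuotient : TopologicalSpace TorusModNeg) =
        m.toPseudoMetricSpace.toUniformSpace.toTopologicalSpace),
      @IsCwExpansive TorusModNeg (m.replaceTopology hm) 2 sphereMap :=
  ⟨nonempty_homeomorph_sphere, isCwExpansive_sphereMap⟩
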